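/- Let $k\ge 1$ be an integer and let $p\ge k+3$ be a prime. For a partition $\lambda$ let $n_\lambda$ denote the product of its parts, let $\ell(\lambda)$ denote the number of its parts (with multiplicity), and let $\mathcal P_p$ be the set of partitions (of arbitrary size) none of whose parts is divisible by $p$. Then the series $$\zeta_{\mathcal P_p}(\{s\}^k)=\sum_{\lambda\in\mathcal P_p,\ \ell(\lambda)=k}\frac1{n_\lambda^{s}}$$ converges absolutely for $\operatorname{Re}(s)>1$ and has a (necessarily unique) holomorphic continuation to $\mathbb C\setminus\{1,\tfrac12,\dots,\tfrac1k\}$, again denoted $\zeta_{\mathcal P_p}(\{s\}^k)$. Moreover, there is a continuous function $G:\mathbb Z_p\to\mathbb Q_p$ which agrees with $\zeta_{\mathcal P_p}(\{s\}^k)$ at every negative integer $n\equiv -1\pmod{p-1}$; that is, for each such $n$ the value $\zeta_{\mathcal P_p}(\{n\}^k)$ is a rational number and $G(n)$ is the same rational number. In particular, the set $A$ of integers at which the two functions agree in this sense contains a positive proportion of the integers: $\liminf_{N\to\infty}\frac{\#(A\cap[-N,N])}{2N+1}>0$. -/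

import Mathlib

/-- Partitions `λ` of length `k` (that is, with exactly `k` parts, counted with multiplicity), of
arbitrary size, none of whose parts is divisible by `p`. -/
def PartitionsPrimeTo (p k : ℕ) : Type :=
  {l : Σ n : ℕ, Nat.Partition n // l.2.parts.card = k ∧ ∀ i ∈ l.2.parts, ¬ p ∣ i}

/-- The integer `n_λ` of a partition: the product of its parts. -/
def PartitionsPrimeTo.integer {p k : ℕ} (l : PartitionsPrimeTo p k) : ℕ :=
  l.1.2.parts.prod

/-- `Z` is the analytically continued partition zeta function `s ↦ ζ_{𝒫_p}({s}^k)`: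
for `Re s > 1` it is the sum of the (unordered, absolutely convergent) series `∑ n_λ ^ (-s)` over
the partitions of length `k` with parts prime to `p`, and it is holomorphic on `ℂ` outside the
points `1, 1/2, …, 1/k`. By the identity theorem these conditions determine `Z` outside those
finitely many points. -/
def IsPartitionZeta (p k : ℕ) (Z : ℂ → ℂ) : Prop :=
  (∀ s : ℂ, 1 < s.re →
    HasSum (fun l : PartitionsPrimeTo p k => 1 / (l.integer : ℂ) ^ s) (Z s)) ∧
  DifferentiableOn ℂ Z {s : ℂ | ∀ j ∈ Finset.Icc 1 k, s ≠ 1 / (j : ℂ)}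

/-- The value of the complex function `Z` at the integer `n` is a rational number, and the value
of the `p`-adic function `G` at `n` is the same rational number. -/
def AgreeAt {p : ℕ} [Fact p.Prime] (Z : ℂ → ℂ) (G : ℤ_[p] → ℚ_[p]) (n : ℤ) : Prop :=
  ∃ q : ℚ, Z (n : ℂ) = (q : ℂ) ∧ G (n : ℤ_[p]) = (q : ℚ_[p])

/-- The set `A` contains a positive proportion of the integers: its lower asymptotic density
`liminf #(A ∩ [-N, N]) / (2 N + 1)` is positive. -/
def PositiveProportion (A : Set ℤ) : Prop :=
  ∃ δ : ℝ, 0 < δ ∧ ∀ᶠ N : ℕ in Filter.atTop,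
    δ ≤ ((A ∩ Set.Icc (-(N : ℤ)) (N : ℤ)).ncard : ℝ) / (2 * (N : ℝ) + 1)

/-! The sum over partitions with `k` parts prime to `p` is the complete homogeneous symmetric
function of degree `k` in the numbers `n ^ (-s)`, `p ∤ n`. Newton's identity (`hasSum_sym_prod`)
makes it a rational polynomial in the power sums `zetaPrimeTo p (i * s)`, `1 ≤ i ≤ k`, which
continue holomorphically away from `s = 1 / i`.

At `s = -(1 + (p - 1) t)` the `i`-th power sum is minus the divided Bernoulli number of index `m = i
(1 + (p - 1) t) + 1`. Here `m ≡ i + 1` modulo `p - 1`, and `0 < i + 1 < p - 1` because `k + 3 ≤ p`,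
so Kummer's congruences (`norm_dividedBernoulli_sub_le`) make it a `p`-adically Lipschitz function
of `t`. It extends to `ℤ_[p]`, and the same polynomial in the extensions gives `G`. -/

open Filter Topology

/-! ### Complete homogeneous sums and Newton's identity -/

/-- The complete homogeneous symmetric functions in terms of the power sums `P 1, P 2, …`, by
Newton's identity `n h_n = ∑_{i=1}^n P i h_{n-i}`. -/
def completeOfPowerSum {K : Type*} [Field K] (P : ℕ → K) : ℕ → K
  | 0 => 1
  | n + 1 => (∑ i : Fin (n + 1), P (i + 1) * completeOfPowerSum P (n - i)) / (n + 1 : ℕ)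
  decreasing_by omega

theorem completeOfPowerSum_zero {K : Type*} [Field K] (P : ℕ → K) :
    completeOfPowerSum P 0 = 1 := by
  rw [completeOfPowerSum]

theorem completeOfPowerSum_succ {K : Type*} [Field K] (P : ℕ → K) (n : ℕ) :
    completeOfPowerSum P (n + 1) =
      (∑ i : Fin (n + 1), P (i + 1) * completeOfPowerSum P (n - i)) / (n + 1 : ℕ) := by
  rw [completeOfPowerSum]

theorem completeOfPowerSum_congr {K : Type*} [Field K] {P Q : ℕ → K} {n : ℕ}
    (h : ∀ i ∈ Finset.Icc 1 n, P i = Q i) : completeOfPowerSum P n = completeOfPowerSum Q n := by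
  induction n using Nat.strong_induction_on with
  | _ n ih =>
    cases n with
    | zero => simp [completeOfPowerSum_zero]
    | succ n =>
      rw [completeOfPowerSum_succ, completeOfPowerSum_succ]
      congr 1
      refine Finset.sum_congr rfl fun i _ => ?_
      have hi := i.2
      rw [h _ (by simp only [Finset.mem_Icc]; omega), ih (n - i) (by omega) fun j hj => h j ?_]
      simp only [Finset.mem_Icc] at hj ⊢
      omega

theorem map_completeOfPowerSum {K L : Type*} [Field K] [Field L] (φ : K →+* L) (P : ℕ → K)
    (n : ℕ) : φ (completeOfPowerSum P n) = completeOfPowerSum (fun i => φ (P i)) n := by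
  induction n using Nat.strong_induction_on with
  | _ n ih =>
    cases n with
    | zero => simp [completeOfPowerSum_zero]
    | succ n =>
      rw [completeOfPowerSum_succ, completeOfPowerSum_succ, map_div₀, map_sum, map_natCast]
      congr 1
      refine Finset.sum_congr rfl fun i _ => ?_
      rw [map_mul, ih (n - i) (by omega)]

theorem completeOfPowerSum_continuous {X K : Type*} [TopologicalSpace X] [Field K]
    [TopologicalSpace K] [IsTopologicalRing K] {P : ℕ → X → K} {n : ℕ}
    (h : ∀ i ∈ Finset.Icc 1 n, Continuous (P i)) :
    Continuous fun x => completeOfPowerSum (fun i => P i x) n := by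
  induction n using Nat.strong_induction_on with
  | _ n ih =>
    cases n with
    | zero => simpa [completeOfPowerSum_zero] using continuous_const
    | succ n =>
      simp only [completeOfPowerSum_succ, div_eq_mul_inv]
      refine Continuous.mul (continuous_finsetSum _ fun i _ => ?_) continuous_const
      have hi := i.2
      refine (h _ (by simp only [Finset.mem_Icc]; omega)).mul
        (ih (n - i) (by omega) fun j hj => h j ?_)
      simp only [Finset.mem_Icc] at hj ⊢
      omega

theorem completeOfPowerSum_differentiableAt {P : ℕ → ℂ → ℂ} {n : ℕ} {s : ℂ}
    (h : ∀ i ∈ Finset.Icc 1 n, DifferentiableAt ℂ (P i) s) :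
    DifferentiableAt ℂ (fun x => completeOfPowerSum (fun i => P i x) n) s := by
  induction n using Nat.strong_induction_on with
  | _ n ih =>
    cases n with
    | zero => simp [completeOfPowerSum_zero]
    | succ n =>
      simp only [completeOfPowerSum_succ]
      refine DifferentiableAt.div_const (DifferentiableAt.fun_sum fun i _ => ?_) _
      have hi := i.2
      refine (h _ (by simp only [Finset.mem_Icc]; omega)).fun_mul
        (ih (n - i) (by omega) fun j hj => h j ?_)
      simp only [Finset.mem_Icc] at hj ⊢
      omega

/-- Adjoin `i + 1` copies of an element to a multiset of size `n - i`. -/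
def Sym.adjoin {α : Type*} {n : ℕ} (x : Σ i : Fin (n + 1), α × Sym α (n - i)) : Sym α (n + 1) :=
  ⟨Multiset.replicate (x.1 + 1) x.2.1 + x.2.2.1, by
    have := x.1.2
    have := x.2.2.2
    rw [Multiset.card_add, Multiset.card_replicate]
    omega⟩

/-- A multiset of size `n + 1` arises in `n + 1` ways by adjoining copies of an element to a
smaller one. -/
theorem Sym.bijective_adjoin_fiber {α : Type*} [DecidableEq α] {n : ℕ} (l : Sym α (n + 1)) :
    Function.Bijective (fun x : {x : Σ i : Fin (n + 1), α × Sym α (n - i) // Sym.adjoin x = l} =>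
      (⟨x.1.2.1, ⟨x.1.1, by
        have hx : (Sym.adjoin x.1).1 = l.1 := congrArg Subtype.val x.2
        rw [← hx]
        simp only [Sym.adjoin, Multiset.count_add, Multiset.count_replicate_self]
        omega⟩⟩ : l.1.ToType)) := by
  constructor
  · rintro ⟨⟨i, a, μ⟩, hx⟩ ⟨⟨j, b, ν⟩, hy⟩ h
    have h1 : a = b := congrArg (fun z : l.1.ToType => z.1) h
    have h2 : i.1 = j.1 := congrArg (fun z : l.1.ToType => z.2.1) h
    obtain rfl : i = j := Fin.ext h2
    subst h1
    have h3 := congrArg Subtype.val (hx.trans hy.symm)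
    simp only [Sym.adjoin, add_right_inj] at h3
    have h4 : μ = ν := Subtype.ext h3
    subst h4
    rfl
  · rintro ⟨a, i⟩
    have hle : Multiset.replicate (i.1 + 1) a ≤ l.1 := Multiset.le_count_iff_replicate_le.1 i.2
    have hcard : i.1 + 1 ≤ n + 1 := by
      have := Multiset.card_le_card hle
      rwa [Multiset.card_replicate, l.2] at this
    refine ⟨⟨⟨⟨i.1, by omega⟩, a, ⟨l.1 - Multiset.replicate (i.1 + 1) a, ?_⟩⟩, ?_⟩, ?_⟩
    · rw [Multiset.card_sub hle, Multiset.card_replicate, l.2]; simp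
    · exact Subtype.ext (add_tsub_cancel_of_le hle)
    · rfl

theorem summable_sigma_of_finite {K : Type*} [RCLike K]
    {ι : Type*} [Finite ι] {β : ι → Type*} {f : (Σ i, β i) → K}
    (h : ∀ i, Summable fun y => f ⟨i, y⟩) : Summable f :=
  .of_norm <| (summable_sigma_of_nonneg fun _ => norm_nonneg _).2
    ⟨fun i => (h i).norm, summable_of_hasFiniteSupport (Set.toFinite _)⟩

theorem hasSum_mul_prod {K : Type*} [RCLike K]
    {α β : Type*} {f : α → K} {g : β → K} {a b : K} (hf : HasSum f a)
    (hg : HasSum g b) : HasSum (fun x : α × β => f x.1 * g x.2) (a * b) :=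
  HasSum.mul hf hg (summable_mul_of_summable_norm hf.summable.norm hg.summable.norm)

/-- The sum over multisets of size `n` of the products of a family is the complete homogeneous
symmetric function of the power sums of the family. -/
theorem hasSum_sym_prod {K : Type*} [RCLike K]
    {α : Type*} {f : α → K} {P : ℕ → K} (n : ℕ)
    (h : ∀ i ∈ Finset.Icc 1 n, HasSum (fun a => f a ^ i) (P i)) :
    HasSum (fun l : Sym α n => (l.1.map f).prod) (completeOfPowerSum P n) := by
  classical
  induction n using Nat.strong_induction_on with
  | _ n ih =>
    cases n with
    | zero =>
      rw [completeOfPowerSum_zero]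
      have h1 := hasSum_unique (fun l : Sym α 0 => (l.1.map f).prod)
      have h2 : (default : Sym α 0).1 = 0 := Multiset.card_eq_zero.1 (default : Sym α 0).2
      rwa [h2, Multiset.map_zero, Multiset.prod_zero] at h1
    | succ n =>
      have hterm (i : Fin (n + 1)) : HasSum (fun x : α × Sym α (n - i) =>
          f x.1 ^ (i + 1 : ℕ) * (x.2.1.map f).prod)
          (P (i + 1) * completeOfPowerSum P (n - i)) := by
        have hi := i.2
        have h1 := h (i + 1) (by simp only [Finset.mem_Icc]; omega)
        have h2 := ih (n - i) (by omega) fun j hj => h j (by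
          simp only [Finset.mem_Icc] at hj ⊢; omega)
        have h3 := hasSum_mul_prod h1 h2
        exact h3
      have hX : HasSum (fun x : Σ i : Fin (n + 1), α × Sym α (n - i) =>
          f x.2.1 ^ (x.1 + 1 : ℕ) * (x.2.2.1.map f).prod)
          (∑ i : Fin (n + 1), P (i + 1) * completeOfPowerSum P (n - i)) :=
        HasSum.sigma_of_hasSum (hasSum_fintype _) hterm
          (summable_sigma_of_finite fun i => (hterm i).summable)
      -- Regroup by the resulting multiset `l`: its fibre is in bijection with the `n + 1` elements
      -- of `l` counted with multiplicity, and every term of the fibre equals the monomial of `l`.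
      have hfib := ((Equiv.sigmaFiberEquiv (Sym.adjoin (α := α) (n := n))).hasSum_iff.2 hX)
      have hl : HasSum (fun l : Sym α (n + 1) => ((n + 1 : ℕ) : K) * (l.1.map f).prod)
          (∑ i : Fin (n + 1), P (i + 1) * completeOfPowerSum P (n - i)) := by
        refine HasSum.sigma hfib fun l => ?_
        let e := Equiv.ofBijective _ (Sym.bijective_adjoin_fiber l)
        have h1 : HasSum (fun _ : l.1.ToType => (l.1.map f).prod)
            (((n + 1 : ℕ) : K) * (l.1.map f).prod) := by
          convert hasSum_fintype (fun _ : l.1.ToType => (l.1.map f).prod) using 1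
          rw [Finset.sum_const, Finset.card_univ, Multiset.card_coe, l.2, nsmul_eq_mul]
        convert e.hasSum_iff.2 h1 using 1
        funext x
        obtain ⟨x, rfl⟩ := x
        change f x.2.1 ^ (x.1 + 1 : ℕ) * (x.2.2.1.map f).prod = ((Sym.adjoin x).1.map f).prod
        rw [Sym.adjoin, Multiset.map_add, Multiset.prod_add, Multiset.map_replicate,
          Multiset.prod_replicate]
      rw [completeOfPowerSum_succ]
      have hn : ((n + 1 : ℕ) : K) ≠ 0 := Nat.cast_ne_zero.2 n.succ_ne_zero
      simpa only [mul_div_cancel_left₀ _ hn] using hl.div_const ((n + 1 : ℕ) : K)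

/-! ### Continuation of the partition zeta function -/

/-- The Riemann zeta function with the Euler factor at `p` removed. -/
noncomputable def zetaPrimeTo (p : ℕ) (s : ℂ) : ℂ := (1 - (p : ℂ) ^ (-s)) * riemannZeta s

/-- The multiples of `p` contribute `p ^ (-s) ζ(s)`. Zero is among them, with zero term, so it does
no harm. -/
theorem hasSum_zetaPrimeTo {p : ℕ} (hp : p ≠ 0) {s : ℂ} (hs : 1 < s.re) :
    HasSum (fun n : {n : ℕ // ¬ p ∣ n} => 1 / (n : ℂ) ^ s) (zetaPrimeTo p s) := by
  have hsum : HasSum (fun n : ℕ => 1 / (n : ℂ) ^ s) (riemannZeta s) := by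
    rw [zeta_eq_tsum_one_div_nat_cpow hs]
    exact (Complex.summable_one_div_nat_cpow.2 hs).hasSum
  have hmul : HasSum (fun n : {n : ℕ | p ∣ n} => 1 / ((n : ℕ) : ℂ) ^ s)
      ((p : ℂ) ^ (-s) * riemannZeta s) := by
    let e : ℕ ≃ {n : ℕ | p ∣ n} := Equiv.ofBijective (fun n => ⟨p * n, dvd_mul_right p n⟩)
      ⟨fun a b h => Nat.eq_of_mul_eq_mul_left (Nat.pos_of_ne_zero hp) (congrArg Subtype.val h),
        fun ⟨b, c, hc⟩ => ⟨c, Subtype.ext hc.symm⟩⟩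
    have he : (fun n : {n : ℕ | p ∣ n} => 1 / ((n : ℕ) : ℂ) ^ s) ∘ e =
        fun n : ℕ => (p : ℂ) ^ (-s) * (1 / (n : ℂ) ^ s) := by
      funext n
      change 1 / (((p * n : ℕ) : ℕ) : ℂ) ^ s = _
      rw [Nat.cast_mul, Complex.natCast_mul_natCast_cpow, Complex.cpow_neg]
      ring
    rw [← e.hasSum_iff, he]
    exact hsum.mul_left ((p : ℂ) ^ (-s))
  rw [zetaPrimeTo, sub_mul, one_mul]
  have hcompl := (HasSum.hasSum_iff_compl (f := fun n : ℕ => 1 / (n : ℂ) ^ s) hmul).1 hsum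
  exact hcompl

theorem differentiableAt_zetaPrimeTo {p : ℕ} (hp : p ≠ 0) {s : ℂ} (hs : s ≠ 1) :
    DifferentiableAt ℂ (zetaPrimeTo p) s := by
  refine DifferentiableAt.fun_mul ?_ (differentiableAt_riemannZeta hs)
  exact (differentiableAt_const _).sub
    (differentiableAt_id.neg.const_cpow (Or.inl (Nat.cast_ne_zero.2 hp)))

/-- The partition with a given multiset of `k` parts, all prime to `p`. -/
def PartitionsPrimeTo.ofSym {p k : ℕ} (m : Sym {n : ℕ // ¬ p ∣ n} k) : PartitionsPrimeTo p k :=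
  ⟨⟨(m.1.map Subtype.val).sum,
    { parts := m.1.map Subtype.val
      parts_pos := fun {i} hi => by
        obtain ⟨n, -, rfl⟩ := Multiset.mem_map.1 hi
        exact Nat.pos_of_ne_zero fun h => n.2 (h ▸ dvd_zero p)
      parts_sum := rfl }⟩, by
    refine ⟨(Multiset.card_map _ _).trans m.2, fun i hi => ?_⟩
    obtain ⟨n, -, rfl⟩ := Multiset.mem_map.1 hi
    exact n.2⟩

theorem PartitionsPrimeTo.bijective_ofSym (p k : ℕ) :
    Function.Bijective (PartitionsPrimeTo.ofSym (p := p) (k := k)) := by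
  constructor
  · intro a b h
    exact Subtype.ext (Multiset.map_injective Subtype.val_injective
      (congrArg (fun l : PartitionsPrimeTo p k => l.1.2.parts) h))
  · rintro ⟨⟨n, ⟨l, hpos, rfl⟩⟩, hcard, hl⟩
    dsimp only at hcard hl
    lift l to Multiset {n : ℕ // ¬ p ∣ n} using hl
    exact ⟨⟨l, by rwa [Multiset.card_map] at hcard⟩, rfl⟩

theorem natCast_multiset_prod_cpow (m : Multiset ℕ) (s : ℂ) :
    1 / ((m.prod : ℕ) : ℂ) ^ s = (m.map fun n : ℕ => 1 / (n : ℂ) ^ s).prod := by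
  induction m using Multiset.induction_on with
  | empty => simp
  | cons a m ih =>
    rw [Multiset.map_cons, Multiset.prod_cons, Multiset.prod_cons, ← ih, Nat.cast_mul,
      Complex.natCast_mul_natCast_cpow]
    ring

/-- The partition zeta function, continued by expressing it through the Riemann zeta function. -/
noncomputable def partitionZeta (p k : ℕ) (s : ℂ) : ℂ :=
  completeOfPowerSum (fun i => zetaPrimeTo p (i * s)) k

theorem isPartitionZeta_partitionZeta {p : ℕ} (hp : p ≠ 0) (k : ℕ) :
    IsPartitionZeta p k (partitionZeta p k) := by
  constructor
  · intro s hs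
    refine (Equiv.ofBijective _ (PartitionsPrimeTo.bijective_ofSym p k)).hasSum_iff.1 ?_
    have h := hasSum_sym_prod (f := fun n : {n : ℕ // ¬ p ∣ n} => 1 / ((n : ℕ) : ℂ) ^ s)
      (P := fun i => zetaPrimeTo p (i * s)) k fun i hi => by
        have hi1 : (1 : ℝ) ≤ i := by exact_mod_cast (Finset.mem_Icc.1 hi).1
        have hre : 1 < ((i : ℂ) * s).re := by
          rw [← Complex.ofReal_natCast, Complex.re_ofReal_mul]
          nlinarith
        have hpow (n : {n : ℕ // ¬ p ∣ n}) :
            (1 / ((n : ℕ) : ℂ) ^ s) ^ i = 1 / ((n : ℕ) : ℂ) ^ ((i : ℂ) * s) := by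
          rw [div_pow, one_pow, Complex.cpow_nat_mul]
        simp only [hpow]
        exact hasSum_zetaPrimeTo hp hre
    have hprod (m : Sym {n : ℕ // ¬ p ∣ n} k) :
        1 / ((PartitionsPrimeTo.ofSym m).integer : ℂ) ^ s =
          (m.1.map fun n : {n : ℕ // ¬ p ∣ n} => 1 / ((n : ℕ) : ℂ) ^ s).prod := by
      change 1 / (((m.1.map Subtype.val).prod : ℕ) : ℂ) ^ s = _
      rw [natCast_multiset_prod_cpow, Multiset.map_map]
      rfl
    simp only [← hprod] at h
    exact h
  · intro s hs
    refine (completeOfPowerSum_differentiableAt fun i hi => ?_).differentiableWithinAt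
    have hi0 : (i : ℂ) ≠ 0 := Nat.cast_ne_zero.2 (by have := (Finset.mem_Icc.1 hi).1; omega)
    refine (differentiableAt_zetaPrimeTo hp fun h => hs i hi ?_).comp s
      ((differentiableAt_const _).mul differentiableAt_id)
    exact eq_one_div_of_mul_eq_one_right h

/-! ### Bernoulli numbers as `p`-adic limits -/

/-- The value `(1 - p ^ (m - 1)) B_m / m`, which is `-ζ (1 - m)` with the Euler factor at `p`
removed when `2 ≤ m`. -/
noncomputable def dividedBernoulli (p m : ℕ) : ℚ := (1 - (p : ℚ) ^ (m - 1)) * bernoulli m / m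

/-- The numbers below `p ^ M` that are prime to `p`. -/
def primeToBelow (p M : ℕ) : Finset ℕ := {j ∈ Finset.range (p ^ M) | ¬ p ∣ j}

section

variable {p : ℕ} [hp : Fact p.Prime]

theorem tendsto_natCast_prime_pow_padic :
    Tendsto (fun M : ℕ => (p : ℚ_[p]) ^ M) atTop (𝓝 0) := by
  refine tendsto_pow_atTop_nhds_zero_of_norm_lt_one ?_
  rw [Padic.norm_p]
  exact inv_lt_one_of_one_lt₀ (by exact_mod_cast hp.out.one_lt)

/-- Bernoulli numbers are the `p`-adic limits of mean values of powers. -/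
theorem tendsto_sum_pow_div_prime_pow (m : ℕ) :
    Tendsto (fun M : ℕ => (∑ j ∈ Finset.range (p ^ M), (j : ℚ_[p]) ^ m) / (p : ℚ_[p]) ^ M) atTop
      (𝓝 ((bernoulli m : ℚ) : ℚ_[p])) := by
  have hp0 : (p : ℚ_[p]) ≠ 0 := Nat.cast_ne_zero.2 hp.out.ne_zero
  -- Faulhaber's polynomial divided by its variable; only the term `i = m` survives at `0`.
  let F : ℚ_[p] → ℚ_[p] := fun x => ∑ i ∈ Finset.range (m + 1),
    ((bernoulli i : ℚ) : ℚ_[p]) * ((m + 1).choose i : ℚ_[p]) * x ^ (m - i) / (m + 1)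
  have hF : Continuous F := by fun_prop
  have hF0 : F 0 = ((bernoulli m : ℚ) : ℚ_[p]) := by
    have hm : (m : ℚ_[p]) + 1 ≠ 0 := by exact_mod_cast m.succ_ne_zero
    simp only [F]
    rw [Finset.sum_range_succ, Finset.sum_eq_zero fun i hi => ?_]
    · rw [Nat.sub_self, pow_zero, Nat.choose_succ_self_right]
      push_cast
      field_simp
      ring
    · rw [zero_pow (by have := Finset.mem_range.1 hi; omega)]
      simp
  rw [← hF0]
  refine ((hF.tendsto 0).comp tendsto_natCast_prime_pow_padic).congr fun M => ?_
  have h := congrArg (Rat.cast : ℚ → ℚ_[p]) (sum_range_pow (p ^ M) m)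
  push_cast at h
  rw [h, Finset.sum_div]
  refine Finset.sum_congr rfl fun i hi => ?_
  rw [show m + 1 - i = m - i + 1 by have := Finset.mem_range.1 hi; omega, pow_succ]
  have hpM : (p : ℚ_[p]) ^ M ≠ 0 := pow_ne_zero _ hp0
  field_simp

theorem sum_primeToBelow_succ {K : Type*} [AddCommGroup K] (f : ℕ → K) (M : ℕ) :
    ∑ j ∈ primeToBelow p (M + 1), f j =
      ∑ j ∈ Finset.range (p ^ (M + 1)), f j - ∑ j ∈ Finset.range (p ^ M), f (p * j) := by
  rw [eq_sub_iff_add_eq, primeToBelow,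
    ← Finset.sum_filter_not_add_sum_filter (Finset.range (p ^ (M + 1))) (fun j => p ∣ j)]
  congr 1
  refine Finset.sum_bij (fun j _ => p * j) (fun j hj => ?_)
    (fun a _ b _ h => Nat.eq_of_mul_eq_mul_left hp.out.pos h) (fun b hb => ?_) (fun _ _ => rfl)
  · rw [Finset.mem_range] at hj
    rw [Finset.mem_filter, Finset.mem_range, pow_succ']
    exact ⟨Nat.mul_lt_mul_of_pos_left hj hp.out.pos, dvd_mul_right _ _⟩
  · rw [Finset.mem_filter, Finset.mem_range, pow_succ'] at hb
    obtain ⟨hb, c, rfl⟩ := hb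
    exact ⟨c, Finset.mem_range.2 (Nat.lt_of_mul_lt_mul_left hb), rfl⟩

/-- Discarding the multiples `p * j` subtracts `p ^ (m - 1)` times the mean value one level lower,
whence the Euler factor. -/
theorem tendsto_sum_primeToBelow_pow_div {m : ℕ} (hm : m ≠ 0) :
    Tendsto (fun M : ℕ => (∑ j ∈ primeToBelow p M, (j : ℚ_[p]) ^ m) / (p : ℚ_[p]) ^ M) atTop
      (𝓝 ((m * dividedBernoulli p m : ℚ) : ℚ_[p])) := by
  have hp0 : (p : ℚ_[p]) ≠ 0 := Nat.cast_ne_zero.2 hp.out.ne_zero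
  have hm0 : (m : ℚ_[p]) ≠ 0 := Nat.cast_ne_zero.2 hm
  have h := tendsto_sum_pow_div_prime_pow (p := p) m
  refine (tendsto_add_atTop_iff_nat 1).1 ?_
  have h2 := ((tendsto_add_atTop_iff_nat 1).2 h).sub (h.const_mul ((p : ℚ_[p]) ^ (m - 1)))
  convert h2 using 2
  · rename_i M
    rw [sum_primeToBelow_succ]
    have hpM : (p : ℚ_[p]) ^ M ≠ 0 := pow_ne_zero _ hp0
    obtain ⟨n, rfl⟩ := Nat.exists_eq_succ_of_ne_zero hm
    simp only [Nat.cast_mul, mul_pow, ← Finset.mul_sum, Nat.succ_eq_add_one, Nat.add_sub_cancel,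
      pow_succ (p : ℚ_[p])]
    field_simp
  · rw [dividedBernoulli]
    push_cast
    field_simp

theorem mul_mod_mem_primeToBelow {c : ℕ} (hc : ¬ p ∣ c) {M j : ℕ}
    (hj : j ∈ primeToBelow p (M + 1)) :
    c * j % p ^ (M + 1) ∈ primeToBelow p (M + 1) := by
  rw [primeToBelow, Finset.mem_filter, Finset.mem_range] at hj ⊢
  refine ⟨Nat.mod_lt _ (pow_pos hp.out.pos _), fun h => ?_⟩
  rw [Nat.dvd_mod_iff (dvd_pow_self p M.succ_ne_zero)] at h
  exact (hp.out.dvd_mul.1 h).elim hc hj.2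

theorem sum_primeToBelow_mul_mod {K : Type*} [AddCommMonoid K] (f : ℕ → K) {c : ℕ} (hc : ¬ p ∣ c)
    (M : ℕ) : ∑ j ∈ primeToBelow p (M + 1), f (c * j % p ^ (M + 1)) =
      ∑ j ∈ primeToBelow p (M + 1), f j := by
  have hmaps : Set.MapsTo (fun j => c * j % p ^ (M + 1)) (primeToBelow p (M + 1) : Set ℕ)
    (primeToBelow p (M + 1)) := fun j hj => mul_mod_mem_primeToBelow hc hj
  have hinj : Set.InjOn (fun j => c * j % p ^ (M + 1)) (primeToBelow p (M + 1)) := by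
    intro a ha b hb hab
    have hco : Nat.gcd (p ^ (M + 1)) c = 1 :=
      Nat.Coprime.pow_left _ ((Nat.Prime.coprime_iff_not_dvd hp.out).2 hc)
    have h := Nat.ModEq.cancel_left_of_coprime hco (show c * a ≡ c * b [MOD p ^ (M + 1)] from hab)
    simp only [primeToBelow, Finset.coe_filter, Finset.mem_range, Set.mem_ofPred_eq] at ha hb
    exact h.eq_of_lt_of_lt ha.1 hb.1
  exact Finset.sum_bij (fun j _ => c * j % p ^ (M + 1)) (fun j hj => hmaps hj)
    (fun a ha b hb h => hinj ha hb h)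
    (fun b hb => by
      obtain ⟨a, ha, h⟩ := Finset.surjOn_of_injOn_of_card_le _ hmaps hinj le_rfl hb
      exact ⟨a, ha, h⟩) (fun _ _ => rfl)

/-- Riemann sums for the integral of `x ^ n` against the regularized Bernoulli measure. -/
def bernoulliRiemannSum (p c n M : ℕ) : ℕ :=
  ∑ j ∈ primeToBelow p M, (c * j % p ^ M) ^ n * (c * j / p ^ M)

/-- Write `c j = r + p ^ M q` with remainder `r` and expand `(c j) ^ m` to first order in `p ^ M q`.
Since `j ↦ r` permutes the residues prime to `p`, summation gives `(c ^ m - 1) ∑ j ^ m` as `m p ^ M`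
times the Riemann sum, up to a multiple of `p ^ (2 M)`. Divide by `m p ^ M`. -/
theorem tendsto_bernoulliRiemannSum {c : ℕ} (hc : ¬ p ∣ c) {m : ℕ} (hm : m ≠ 0) :
    Tendsto (fun M : ℕ => (bernoulliRiemannSum p c (m - 1) M : ℚ_[p])) atTop
      (𝓝 (((c : ℚ_[p]) ^ m - 1) * (dividedBernoulli p m : ℚ_[p]))) := by
  have hp0 : (p : ℚ_[p]) ≠ 0 := Nat.cast_ne_zero.2 hp.out.ne_zero
  have hm0 : (m : ℚ_[p]) ≠ 0 := Nat.cast_ne_zero.2 hm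
  refine (tendsto_add_atTop_iff_nat 1).1 ?_
  have h1 := ((tendsto_add_atTop_iff_nat 1).2
    (tendsto_sum_primeToBelow_pow_div (p := p) hm)).const_mul (((c : ℚ_[p]) ^ m - 1) / m)
  have hval : ((c : ℚ_[p]) ^ m - 1) / m * ((m * dividedBernoulli p m : ℚ) : ℚ_[p]) =
      ((c : ℚ_[p]) ^ m - 1) * (dividedBernoulli p m : ℚ_[p]) := by
    push_cast
    field_simp
  rw [hval] at h1
  -- the second-order remainders
  have hrem (M : ℕ) : ∃ K : ℕ, ((c : ℚ_[p]) ^ m - 1) / m *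
      ((∑ j ∈ primeToBelow p (M + 1), (j : ℚ_[p]) ^ m) / (p : ℚ_[p]) ^ (M + 1)) -
        (bernoulliRiemannSum p c (m - 1) (M + 1) : ℚ_[p]) =
      (p : ℚ_[p]) ^ (M + 1) / m * K := by
    let k : ℕ → ℕ := fun j => (Polynomial.powAddExpansion (c * j % p ^ (M + 1))
      (p ^ (M + 1) * (c * j / p ^ (M + 1))) m).1
    refine ⟨∑ j ∈ primeToBelow p (M + 1), k j * (c * j / p ^ (M + 1)) ^ 2, ?_⟩
    have hexp (j : ℕ) : (c * j) ^ m = (c * j % p ^ (M + 1)) ^ m +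
        m * (c * j % p ^ (M + 1)) ^ (m - 1) * (p ^ (M + 1) * (c * j / p ^ (M + 1))) +
          k j * (p ^ (M + 1) * (c * j / p ^ (M + 1))) ^ 2 := by
      conv_lhs => rw [← Nat.mod_add_div (c * j) (p ^ (M + 1))]
      exact (Polynomial.powAddExpansion _ _ m).2
    have hsum : c ^ m * ∑ j ∈ primeToBelow p (M + 1), j ^ m =
        ∑ j ∈ primeToBelow p (M + 1), j ^ m +
          m * p ^ (M + 1) * bernoulliRiemannSum p c (m - 1) (M + 1) +
          (p ^ (M + 1)) ^ 2 * ∑ j ∈ primeToBelow p (M + 1), k j * (c * j / p ^ (M + 1)) ^ 2 := by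
      have hperm := sum_primeToBelow_mul_mod (fun j => j ^ m) hc M
      simp only [bernoulliRiemannSum, Finset.mul_sum, ← mul_pow]
      rw [← hperm, ← Finset.sum_add_distrib, ← Finset.sum_add_distrib]
      refine Finset.sum_congr rfl fun j _ => ?_
      rw [hexp]
      ring
    have hcast := congrArg (Nat.cast : ℕ → ℚ_[p]) hsum
    have hpM : (p : ℚ_[p]) ^ (M + 1) ≠ 0 := pow_ne_zero _ hp0
    rw [Nat.cast_add, Nat.cast_add, Nat.cast_mul, Nat.cast_mul, Nat.cast_mul, Nat.cast_mul,
      Nat.cast_pow, Nat.cast_pow, Nat.cast_pow, Nat.cast_sum] at hcast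
    simp only [Nat.cast_pow] at hcast
    field_simp
    linear_combination hcast
  choose K hK using hrem
  have h2 : Tendsto (fun M => (p : ℚ_[p]) ^ (M + 1) / m * K M) atTop (𝓝 0) := by
    have h3 := ((tendsto_add_atTop_iff_nat 1).2
      (tendsto_natCast_prime_pow_padic (p := p))).div_const (m : ℚ_[p])
    rw [zero_div] at h3
    refine squeeze_zero_norm (fun M => ?_) (tendsto_zero_iff_norm_tendsto_zero.1 h3)
    rw [norm_mul]
    exact mul_le_of_le_one_right (norm_nonneg _) (by exact_mod_cast Padic.norm_int_le_one (K M))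
  have h4 := h1.sub h2
  rw [sub_zero] at h4
  refine h4.congr fun M => ?_
  rw [← hK, sub_sub_cancel]

end

/-! ### Kummer's congruences and `p`-adic interpolation -/

section

variable {p : ℕ} [hp : Fact p.Prime]

/-- Euler's theorem modulo `p ^ (N + 1)`, whose totient is `p ^ N * (p - 1)`. -/
theorem norm_natCast_pow_sub_pow_le {x : ℕ} (hx : ¬ p ∣ x) {N m n : ℕ}
    (h : m ≡ n [MOD p ^ N * (p - 1)]) :
    ‖(x : ℚ_[p]) ^ m - (x : ℚ_[p]) ^ n‖ ≤ (p : ℝ) ^ (-(N + 1 : ℕ) : ℤ) := by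
  have hco : Nat.Coprime x (p ^ (N + 1)) :=
    (((Nat.Prime.coprime_iff_not_dvd hp.out).2 hx).pow_left _).symm
  have htot : x ^ (p ^ N * (p - 1)) ≡ 1 [MOD p ^ (N + 1)] := by
    have := Nat.ModEq.pow_totient hco
    rwa [Nat.totient_prime_pow_succ hp.out] at this
  have key (a b t : ℕ) (hab : b = a + p ^ N * (p - 1) * t) : x ^ b ≡ x ^ a [MOD p ^ (N + 1)] := by
    rw [hab, pow_add x, pow_mul x]
    simpa using (Nat.ModEq.refl (x ^ a)).mul (htot.pow t)
  have hmod : x ^ n ≡ x ^ m [MOD p ^ (N + 1)] := by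
    rcases le_total m n with hmn | hmn
    · obtain ⟨t, ht⟩ := (Nat.modEq_iff_dvd' hmn).1 h
      exact key m n t (by omega)
    · obtain ⟨t, ht⟩ := (Nat.modEq_iff_dvd' hmn).1 h.symm
      exact (key n m t (by omega)).symm
  have hdvd := (Nat.modEq_iff_dvd).1 hmod
  have := (Padic.norm_int_le_pow_iff_dvd (p := p) _ (N + 1)).2 (by exact_mod_cast hdvd)
  push_cast at this ⊢
  exact this

theorem norm_bernoulliRiemannSum_sub_le {c : ℕ} (hc : ¬ p ∣ c) {N m n : ℕ}
    (h : m ≡ n [MOD p ^ N * (p - 1)]) (M : ℕ) :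
    ‖(bernoulliRiemannSum p c m (M + 1) : ℚ_[p]) - bernoulliRiemannSum p c n (M + 1)‖ ≤
      (p : ℝ) ^ (-(N + 1 : ℕ) : ℤ) := by
  simp only [bernoulliRiemannSum]
  push_cast
  rw [← Finset.sum_sub_distrib]
  refine IsUltrametricDist.norm_sum_le_of_forall_le_of_nonneg (by positivity) fun j hj => ?_
  rw [← sub_mul, norm_mul]
  refine (mul_le_of_le_one_right (norm_nonneg _) ?_).trans
    (norm_natCast_pow_sub_pow_le (Finset.mem_filter.1 (mul_mod_mem_primeToBelow hc hj)).2 h)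
  exact_mod_cast Padic.norm_int_le_one (c * j / p ^ (M + 1) : ℕ)

/-- **Kummer's congruences.** -/
theorem norm_dividedBernoulli_sub_le {N m n : ℕ} (hm : ¬ p - 1 ∣ m)
    (h : m ≡ n [MOD p ^ N * (p - 1)]) :
    ‖(dividedBernoulli p m : ℚ_[p]) - dividedBernoulli p n‖ ≤ (p : ℝ) ^ (-(N + 1 : ℕ) : ℤ) := by
  have hn : ¬ p - 1 ∣ n := fun hn => hm ((h.dvd_iff (dvd_mul_left _ _)).2 hn)
  have hm0 : m ≠ 0 := fun h0 => hm (h0 ▸ dvd_zero _)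
  have hn0 : n ≠ 0 := fun h0 => hn (h0 ▸ dvd_zero _)
  -- a primitive root modulo `p`
  obtain ⟨c, hc, hcm⟩ : ∃ c : ℕ, ¬ p ∣ c ∧ ∀ l, p ∣ c ^ l - 1 → p - 1 ∣ l := by
    obtain ⟨u, hu⟩ := IsCyclic.exists_generator (α := (ZMod p)ˣ)
    have hcast : ((ZMod.val (u : ZMod p) : ℕ) : ZMod p) = u := ZMod.natCast_zmod_val _
    have hndvd : ¬ p ∣ ZMod.val (u : ZMod p) := fun hd =>
      u.ne_zero (hcast ▸ (ZMod.natCast_eq_zero_iff _ _).2 hd)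
    refine ⟨ZMod.val (u : ZMod p), hndvd, fun l hl => ?_⟩
    have h1 : 1 ≤ ZMod.val (u : ZMod p) ^ l :=
      Nat.one_le_pow _ _ (Nat.pos_of_ne_zero fun h0 => hndvd (h0 ▸ dvd_zero p))
    have h2 := (ZMod.natCast_eq_zero_iff _ _).2 hl
    rw [Nat.cast_sub h1, Nat.cast_pow, hcast, Nat.cast_one, sub_eq_zero] at h2
    have h3 : u ^ l = 1 := Units.ext (by simpa using h2)
    have h4 := orderOf_dvd_of_pow_eq_one h3
    rwa [orderOf_eq_card_of_forall_mem_zpowers hu, Nat.card_eq_fintype_card,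
      ZMod.card_units] at h4
  have hc1 (l : ℕ) : 1 ≤ c ^ l :=
    Nat.one_le_pow _ _ (Nat.pos_of_ne_zero fun h0 => hc (h0 ▸ dvd_zero p))
  -- The regularizing factor is a unit, so it can be divided out without loss.
  have hunit {l : ℕ} (hl : ¬ p - 1 ∣ l) : ‖(c : ℚ_[p]) ^ l - 1‖ = 1 := by
    have h1 : ¬ ‖((c ^ l - 1 : ℕ) : ℤ_[p])‖ < 1 := by
      rw [← Int.cast_natCast, PadicInt.norm_int_lt_one_iff_dvd]
      exact fun hd => hl (hcm l (by exact_mod_cast hd))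
    have h2 : ‖((c ^ l - 1 : ℕ) : ℤ_[p])‖ = 1 :=
      le_antisymm (PadicInt.norm_le_one _) (not_lt.1 h1)
    rw [PadicInt.norm_def] at h2
    rw [← h2, PadicInt.coe_natCast, Nat.cast_sub (hc1 l), Nat.cast_pow, Nat.cast_one]
  have htm := tendsto_bernoulliRiemannSum (p := p) hc hm0
  have htn := tendsto_bernoulliRiemannSum (p := p) hc hn0
  have hpred : m - 1 ≡ n - 1 [MOD p ^ N * (p - 1)] := by
    refine Nat.ModEq.add_right_cancel' 1 ?_
    rwa [Nat.sub_add_cancel (by omega), Nat.sub_add_cancel (by omega)]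
  have hdiff : ‖((c : ℚ_[p]) ^ m - 1) * (dividedBernoulli p m : ℚ_[p]) -
      ((c : ℚ_[p]) ^ n - 1) * (dividedBernoulli p n : ℚ_[p])‖ ≤ (p : ℝ) ^ (-(N + 1 : ℕ) : ℤ) :=
    le_of_tendsto ((tendsto_add_atTop_iff_nat 1).2 (htm.sub htn).norm)
      (Eventually.of_forall fun M => norm_bernoulliRiemannSum_sub_le hc hpred M)
  -- Up to that unit, a limit of integers.
  have hint : ‖(dividedBernoulli p n : ℚ_[p])‖ ≤ 1 := by
    have : ‖((c : ℚ_[p]) ^ n - 1) * (dividedBernoulli p n : ℚ_[p])‖ ≤ 1 :=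
      le_of_tendsto htn.norm (Eventually.of_forall fun M => by
        exact_mod_cast Padic.norm_int_le_one (bernoulliRiemannSum p c (n - 1) M : ℕ))
    rwa [norm_mul, hunit hn, one_mul] at this
  have hsplit : ((c : ℚ_[p]) ^ m - 1) *
      ((dividedBernoulli p m : ℚ_[p]) - dividedBernoulli p n) =
      (((c : ℚ_[p]) ^ m - 1) * (dividedBernoulli p m : ℚ_[p]) -
        ((c : ℚ_[p]) ^ n - 1) * (dividedBernoulli p n : ℚ_[p])) +
      -(((c : ℚ_[p]) ^ m - (c : ℚ_[p]) ^ n) * (dividedBernoulli p n : ℚ_[p])) := by ring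
  rw [← one_mul ‖(dividedBernoulli p m : ℚ_[p]) - dividedBernoulli p n‖, ← hunit hm, ← norm_mul,
    hsplit]
  refine (Padic.nonarchimedean _ _).trans (max_le hdiff ?_)
  rw [norm_neg, norm_mul]
  exact (mul_le_of_le_one_right (norm_nonneg _) hint).trans (norm_natCast_pow_sub_pow_le hc h)

/-- A function on the natural numbers which is `p`-adically Lipschitz extends continuously
to the `p`-adic integers. -/
theorem exists_continuous_padicInt_extension {f : ℕ → ℚ_[p]}
    (hf : ∀ a b : ℕ, ‖f a - f b‖ ≤ ‖(a : ℤ_[p]) - b‖) :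
    ∃ F : ℤ_[p] → ℚ_[p], Continuous F ∧ ∀ n : ℕ, F n = f n := by
  let S : Set ℤ_[p] := Set.range (Nat.cast : ℕ → ℤ_[p])
  have hS : Dense S := PadicInt.denseRange_natCast
  choose r hr using fun x : S => x.2
  have hg : UniformContinuous fun x : S => f (r x) := by
    refine LipschitzWith.uniformContinuous (K := 1) (LipschitzWith.of_dist_le_mul fun x y => ?_)
    rw [NNReal.coe_one, one_mul, Subtype.dist_eq, ← hr x, ← hr y, dist_eq_norm, dist_eq_norm]
    exact hf _ _
  refine ⟨hS.extend fun x : S => f (r x), (hS.uniformContinuous_extend hg).continuous, fun n => ?_⟩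
  have h1 := hS.extend_of_ind hg ⟨(n : ℤ_[p]), n, rfl⟩
  refine h1.trans ?_
  have h2 : r ⟨(n : ℤ_[p]), n, rfl⟩ = n := Nat.cast_injective (R := ℤ_[p]) (hr _)
  exact congrArg f h2

/-- The indices stay in the class of `i + 1` modulo `p - 1`, and `a ≡ b` modulo `p ^ N` makes them
congruent modulo `p ^ N * (p - 1)`, as Kummer's congruences require. -/
theorem exists_continuous_dividedBernoulli {i : ℕ} (hi : ¬ p - 1 ∣ i + 1) :
    ∃ F : ℤ_[p] → ℚ_[p], Continuous F ∧
      ∀ t : ℕ, F t = dividedBernoulli p (i * (1 + (p - 1) * t) + 1) := by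
  refine exists_continuous_padicInt_extension
    (f := fun t => (dividedBernoulli p (i * (1 + (p - 1) * t) + 1) : ℚ_[p])) fun a b => ?_
  have hnd (a : ℕ) : ¬ p - 1 ∣ i * (1 + (p - 1) * a) + 1 := by
    rwa [show i * (1 + (p - 1) * a) + 1 = (p - 1) * (i * a) + (i + 1) by ring,
      Nat.dvd_add_right (dvd_mul_right _ _)]
  rcases eq_or_ne a b with rfl | hab
  · simp
  have hne : (a : ℤ_[p]) - b ≠ 0 := sub_ne_zero.2 fun h => hab (Nat.cast_injective h)
  set N := ((a : ℤ_[p]) - b).valuation with hN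
  have hnorm := PadicInt.norm_eq_zpow_neg_valuation hne
  have hdvd : ((p ^ N : ℕ) : ℤ) ∣ (b : ℤ) - a := by
    have h1 : ‖((a - b : ℤ) : ℤ_[p])‖ ≤ (p : ℝ) ^ (-(N : ℤ)) := by
      push_cast
      exact hnorm.le
    have h2 := PadicInt.norm_int_le_pow_iff_dvd.1 h1
    rw [← dvd_neg, neg_sub]
    exact_mod_cast h2
  have hmod : a ≡ b [MOD p ^ N] := Nat.modEq_iff_dvd.2 hdvd
  have h1 : i * (1 + (p - 1) * a) + 1 ≡ i * (1 + (p - 1) * b) + 1 [MOD p ^ N * (p - 1)] := by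
    have h2 := hmod.mul_right' (p - 1)
    rw [mul_comm a, mul_comm b] at h2
    exact ((h2.add_left 1).mul_left i).add_right 1
  refine (norm_dividedBernoulli_sub_le (hnd a) h1).trans ?_
  rw [hnorm]
  exact zpow_le_zpow_right₀ (by exact_mod_cast hp.out.one_le) (by push_cast; omega)

end

/-! ### Special values, density and the conclusion -/

theorem zetaPrimeTo_neg_natCast (p : ℕ) {n : ℕ} (hn : n ≠ 0) :
    zetaPrimeTo p (-n) = ((-dividedBernoulli p (n + 1) : ℚ) : ℂ) := by
  rw [zetaPrimeTo, dividedBernoulli, riemannZeta_neg_nat_eq_bernoulli', neg_neg,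
    Complex.cpow_natCast, bernoulli_eq_bernoulli'_of_ne_one (by omega), Nat.add_sub_cancel]
  push_cast
  ring

theorem positiveProportion_of_neg_progression {A : Set ℤ} {d : ℕ} (hd : 0 < d)
    (h : ∀ t : ℕ, -(1 + d * t : ℤ) ∈ A) : PositiveProportion A := by
  -- At least `N / d` members of the progression lie in `[-N, N]`, and `2 N + 1 ≤ 3 N` for `N ≥ 1`.
  refine ⟨1 / (3 * d), by positivity, eventually_atTop.2 ⟨1, fun N hN => ?_⟩⟩
  have hd' : (0 : ℝ) < d := by exact_mod_cast hd
  have hN' : (1 : ℝ) ≤ N := by exact_mod_cast hN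
  set q := (N - 1) / d with hq
  have hcard : q + 1 ≤ (A ∩ Set.Icc (-(N : ℤ)) N).ncard := by
    have hinj : Function.Injective fun t : ℕ => -(1 + d * t : ℤ) := fun a b hab => by
      have h1 : (d : ℤ) * a = d * b := by simpa using hab
      exact_mod_cast mul_left_cancel₀ (by exact_mod_cast hd.ne') h1
    have hsub : (((Finset.range (q + 1)).image fun t : ℕ => -(1 + d * t : ℤ) : Finset ℤ) : Set ℤ) ⊆
        A ∩ Set.Icc (-(N : ℤ)) N := by
      intro x hx
      obtain ⟨t, ht, rfl⟩ := Finset.mem_image.1 (Finset.mem_coe.1 hx)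
      have h1 : d * t ≤ N - 1 := (Nat.mul_le_mul_left d
        (Nat.lt_succ_iff.1 (Finset.mem_range.1 ht))).trans (Nat.mul_div_le _ _)
      have h2 : ((d * t : ℕ) : ℤ) ≤ N - 1 := by omega
      push_cast at h2
      have h3 : (0 : ℤ) ≤ d * t := by positivity
      exact ⟨h t, by constructor <;> linarith⟩
    have hfin : (A ∩ Set.Icc (-(N : ℤ)) N).Finite := (Set.finite_Icc _ _).inter_of_right _
    calc q + 1 = _ := by
          rw [Set.ncard_coe_finset, Finset.card_image_of_injective _ hinj, Finset.card_range]
      _ ≤ _ := Set.ncard_le_ncard hsub hfin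
  have hNq : N ≤ d * (q + 1) := by
    have := Nat.lt_mul_div_succ (N - 1) hd
    rw [← hq] at this
    omega
  have h1 : (N : ℝ) ≤ d * (A ∩ Set.Icc (-(N : ℤ)) N).ncard := by
    exact_mod_cast hNq.trans (Nat.mul_le_mul_left d hcard)
  rw [div_le_div_iff₀ (by positivity) (by positivity)]
  nlinarith

theorem mainTheorem4 (k p : ℕ) [Fact p.Prime] (hk : 1 ≤ k) (hp : k + 3 ≤ p) :
    ∃ Z : ℂ → ℂ, IsPartitionZeta p k Z ∧
      ∃ G : ℤ_[p] → ℚ_[p], Continuous G ∧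
        (∀ n : ℤ, n < 0 → n ≡ -1 [ZMOD ((p : ℤ) - 1)] → AgreeAt Z G n) ∧
        PositiveProportion {n : ℤ | AgreeAt Z G n} := by
  have hprime : p.Prime := Fact.out
  refine ⟨partitionZeta p k, isPartitionZeta_partitionZeta hprime.ne_zero k, ?_⟩
  have hF (i : ℕ) : ∃ F : ℤ_[p] → ℚ_[p], i ∈ Finset.Icc 1 k → (Continuous F ∧
      ∀ t : ℕ, F t = dividedBernoulli p (i * (1 + (p - 1) * t) + 1)) := by
    by_cases hi : i ∈ Finset.Icc 1 k
    · have h1 := Finset.mem_Icc.1 hi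
      obtain ⟨F, hF⟩ := exists_continuous_dividedBernoulli (p := p) (i := i)
        (Nat.not_dvd_of_pos_of_lt (by omega) (by omega))
      exact ⟨F, fun _ => hF⟩
    · exact ⟨0, fun h => absurd h hi⟩
  choose F hF using hF
  obtain ⟨c, hc⟩ : ∃ c : ℤ_[p], ((p - 1 : ℕ) : ℤ_[p]) * c = 1 := by
    refine IsUnit.exists_right_inv (PadicInt.isUnit_iff.2 (le_antisymm (PadicInt.norm_le_one _)
      (not_lt.1 ?_)))
    rw [← Int.cast_natCast, PadicInt.norm_int_lt_one_iff_dvd]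
    intro hd
    exact Nat.not_dvd_of_pos_of_lt (by omega) (by omega) (Int.natCast_dvd_natCast.1 hd)
  -- Solving `x = -(1 + (p - 1) t)` for `t` gives `-(x + 1) * c`, with `c` the inverse of the unit
  -- `p - 1`.
  let G : ℤ_[p] → ℚ_[p] := fun x => completeOfPowerSum (fun i => -F i (-(x + 1) * c)) k
  have hG : Continuous G := completeOfPowerSum_continuous fun i hi =>
    (((hF i hi).1).comp (by fun_prop)).neg
  have hagree (t : ℕ) : AgreeAt (partitionZeta p k) G (-(1 + (p - 1 : ℕ) * t : ℤ)) := by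
    -- Newton's recursion over `ℚ` gives the common value: it commutes with the embeddings into `ℂ`
    -- and `ℚ_[p]`.
    refine ⟨completeOfPowerSum
      (fun i => -dividedBernoulli p (i * (1 + (p - 1) * t) + 1)) k, ?_, ?_⟩
    · rw [← Rat.coe_castHom, map_completeOfPowerSum, partitionZeta]
      refine completeOfPowerSum_congr fun i hi => ?_
      have hi0 : i * (1 + (p - 1) * t) ≠ 0 :=
        Nat.mul_ne_zero (by have := (Finset.mem_Icc.1 hi).1; omega) (by omega)
      rw [Rat.coe_castHom, ← zetaPrimeTo_neg_natCast p hi0]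
      congr 1
      push_cast
      ring
    · rw [← Rat.coe_castHom, map_completeOfPowerSum]
      refine completeOfPowerSum_congr fun i hi => ?_
      have ht : -(((-(1 + (p - 1 : ℕ) * t : ℤ) : ℤ) : ℤ_[p]) + 1) * c = t := by
        rw [Int.cast_neg, Int.cast_add, Int.cast_mul, Int.cast_one, Int.cast_natCast,
          Int.cast_natCast]
        linear_combination (t : ℤ_[p]) * hc
      rw [ht, (hF i hi).2 t, Rat.coe_castHom, Rat.cast_neg]
  refine ⟨G, hG, fun n hn hmod => ?_,
    positiveProportion_of_neg_progression (d := p - 1) (by omega) hagree⟩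
  obtain ⟨t, ht⟩ := hmod.dvd
  have hp1 : ((p - 1 : ℕ) : ℤ) = (p : ℤ) - 1 := by omega
  have ht0 : 0 ≤ t := by
    by_contra hneg
    have : (0 : ℤ) < (p : ℤ) - 1 := by omega
    nlinarith
  lift t to ℕ using ht0
  have h1 := hagree t
  rwa [hp1, ← ht, show -(1 + (-1 - n)) = n by ring] at h1
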